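/- Let $\lambda\ge\kappa\ge\omega$ be cardinals. A family $\mathcal B$ of sets of size $\kappa$ is called essentially disjoint if for each $B\in\mathcal B$ there is a subset $F(B)\subset B$ with $|F(B)|<\kappa$ such that the sets $B\setminus F(B)$ and $B'\setminus F(B')$ are disjoint for all distinct $B,B'\in\mathcal B$. Let $\mathcal A$ be a family of subsets of $\lambda$, each of cardinality at least $\kappa$, and suppose that $\mathcal A$ is $\kappa$-hereditarily essentially disjoint: for every function $H$ on $\mathcal A$ such that $H(A)\subset A$ and $|H(A)|=\kappa$ for all $A\in\mathcal A$, the family $\{H(A):A\in\mathcal A\}$ is essentially disjoint. Then there is a coloring $c:\lambda\to\kappa$ such that for every $A\in\mathcal A$ the set $$I_c(A)=\{\xi\in\operatorname{ran}(c): |A\cap c^{-1}\{\xi\}|=1\}$$ of colors used by exactly one element of $A$ has cardinality $\kappa$. -/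

import Mathlib

open Cardinal

universe u

namespace SetFamily

/-- A family `𝒜` of sets (of size `κ`) is essentially disjoint if one can remove from each
member `A` a subset `F A ⊆ A` with fewer than `κ` elements so that, for distinct members of `𝒜`,
the remaining sets `A \ F A` are disjoint. -/
def EssentiallyDisjoint {X : Type u} (κ : Cardinal.{u}) (𝒜 : Set (Set X)) : Prop :=
  ∃ F : Set X → Set X, (∀ A ∈ 𝒜, F A ⊆ A ∧ #(F A) < κ) ∧
    𝒜.PairwiseDisjoint (fun A => A \ F A)

/-- `𝒜` is `κ`-hereditarily essentially disjoint if for every choice of subsets `H A ⊆ A` of size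
exactly `κ`, for `A ∈ 𝒜`, the family `{H A : A ∈ 𝒜}` is essentially disjoint. -/
def HereditarilyEssentiallyDisjoint {X : Type u} (κ : Cardinal.{u}) (𝒜 : Set (Set X)) : Prop :=
  ∀ H : Set X → Set X, (∀ A ∈ 𝒜, H A ⊆ A ∧ #(H A) = κ) → EssentiallyDisjoint κ (H '' 𝒜)

/-- The set `I_c(A)` of those colors that are taken by `c` at exactly one element of `A`. -/
def uniqueColors {X K : Type u} (c : X → K) (A : Set X) : Set K :=
  {ξ | ξ ∈ Set.range c ∧ #(A ∩ c ⁻¹' {ξ} : Set X) = 1}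

end SetFamily

namespace SetFamily

variable {X : Type u}

/-! Induction on the size of Y ⊆ X proves more: if each point of Y has forbidden colors in K × K
with vertical sections of size < κ, some coloring of Y avoids them and gives every A with at least κ
points in Y a set I(A) of at least κ colors, each used once on A ∩ Y, at most one over each first
coordinate.

If |Y| ≤ κ, disjoint sets G(A) exist containing all but < κ points of A ∩ Y; the first coordinate is
made injective on each G(A), and the second dodges the forbidden colors
(`exists_uniqueColoring_of_mk_le`).

If |Y| > κ, a catching rank (`exists_catchingRank`) cuts Y into smaller pieces, colored in turn; A
takes its colors from the piece that catches it. A later point lies in at most one set already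
caught, so protecting those colors forbids at most one more color per section. Fewer than κ points
of A come earlier, and their colors are discarded (`exists_uniqueColoring_of_catchingRank`). -/

theorem mk_biUnion_le_of_forall_le {ι : Type u} {ρ : Cardinal.{u}} (hρ : ℵ₀ ≤ ρ) {s : Set ι}
    {f : ι → Set X} (hs : #s ≤ ρ) (hf : ∀ i ∈ s, #(f i) ≤ ρ) : #(⋃ i ∈ s, f i : Set X) ≤ ρ :=
  (mk_biUnion_le f s).trans <|
    (mul_le_mul' hs (ciSup_le' fun i : s => hf i i.2)).trans (mul_eq_self hρ).le

theorem le_mk_diff {κ : Cardinal.{u}} (hκ : ℵ₀ ≤ κ) {S T : Set X} (hS : κ ≤ #S) (hT : #T < κ) :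
    κ ≤ #(S \ T : Set X) := by
  by_contra! h
  refine (hS.trans (le_mk_sdiff_add_mk S T)).not_gt (add_lt_of_lt hκ h hT)

/-! ### Separation of indexed families. -/

/-- For every choice of subsets `H A ⊆ A` of size `κ`, one can remove fewer than `κ` elements from
each `H A` to make the indexed family disjoint. -/
def IndexedSeparable (κ : Cardinal.{u}) (𝒜 : Set (Set X)) : Prop :=
  ∀ H : Set X → Set X, (∀ A ∈ 𝒜, H A ⊆ A ∧ #(H A) = κ) →
    ∃ G : Set X → Set X, (∀ A ∈ 𝒜, G A ⊆ H A ∧ #(H A \ G A : Set X) < κ) ∧ 𝒜.PairwiseDisjoint G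

theorem exists_subset_mk_eq {κ : Cardinal.{u}} {𝒜 : Set (Set X)} (hA : ∀ A ∈ 𝒜, κ ≤ #A) :
    ∃ H : Set X → Set X, ∀ A ∈ 𝒜, H A ⊆ A ∧ #(H A) = κ := by
  have : ∀ A : Set X, ∃ T, A ∈ 𝒜 → T ⊆ A ∧ #T = κ := fun A => by
    by_cases h : A ∈ 𝒜
    · obtain ⟨T, hT⟩ := le_mk_iff_exists_subset.1 (hA A h)
      exact ⟨T, fun _ => hT⟩
    · exact ⟨∅, fun h' => (h h').elim⟩
  choose H hH using this
  exact ⟨H, hH⟩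

theorem HereditarilyEssentiallyDisjoint.mk_inter_lt {κ : Cardinal.{u}} (hκ : ℵ₀ ≤ κ)
    {𝒜 : Set (Set X)} (hA : ∀ A ∈ 𝒜, κ ≤ #A) (h : HereditarilyEssentiallyDisjoint κ 𝒜)
    {A B : Set X} (hAm : A ∈ 𝒜) (hB : B ∈ 𝒜) (hAB : A ≠ B) : #(A ∩ B : Set X) < κ := by
  classical
  by_contra! hle
  obtain ⟨T, hT, hTκ⟩ := le_mk_iff_exists_subset.1 hle
  have hTne : T.Nonempty := by
    rw [← Set.nonempty_coe_sort, ← mk_ne_zero_iff, hTκ]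
    exact (aleph0_pos.trans_le hκ).ne'
  obtain ⟨t, ht⟩ := hTne
  -- Choosing T for both A and B would collapse them to one member of the image family; dropping one
  -- point keeps two members.
  have hT' : #(T \ {t} : Set X) = κ := by
    refine le_antisymm (hTκ ▸ mk_le_mk_of_subset Set.sdiff_subset) ?_
    exact le_mk_diff hκ hTκ.ge (by simpa using one_lt_aleph0.trans_le hκ)
  obtain ⟨H₀, hH₀⟩ := exists_subset_mk_eq hA
  set H := Function.update (Function.update H₀ B (T \ {t})) A T with hH
  have hHA : H A = T := by simp [hH]
  have hHB : H B = T \ {t} := by simp [hH, Function.update_of_ne hAB.symm]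
  obtain ⟨F, hF, hd⟩ := h H fun C hC => by
    by_cases h1 : C = A
    · subst h1
      exact ⟨hHA ▸ hT.trans Set.inter_subset_left, hHA ▸ hTκ⟩
    by_cases h2 : C = B
    · subst h2
      exact ⟨hHB ▸ Set.sdiff_subset.trans (hT.trans Set.inter_subset_right), hHB ▸ hT'⟩
    · simpa [hH, h1, h2] using hH₀ C hC
  have mA : T ∈ H '' 𝒜 := ⟨A, hAm, hHA⟩
  have mB : T \ {t} ∈ H '' 𝒜 := ⟨B, hB, hHB⟩
  have hne : T ≠ T \ {t} := fun he => (he ▸ ht : t ∈ T \ {t}).2 rfl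
  have hdis : Disjoint (T \ F T) ((T \ {t}) \ F (T \ {t})) := hd mA mB hne
  have hsub : T \ {t} ⊆ F T ∪ F (T \ {t}) := fun x hx => by
    by_contra hcon
    rw [Set.mem_union, not_or] at hcon
    exact Set.disjoint_left.1 hdis ⟨hx.1, hcon.1⟩ ⟨hx, hcon.2⟩
  have := (mk_le_mk_of_subset hsub).trans (mk_union_le _ _)
  rw [hT'] at this
  exact this.not_gt (add_lt_of_lt hκ (hF _ mA).2 (hF _ mB).2)

theorem HereditarilyEssentiallyDisjoint.indexedSeparable {κ : Cardinal.{u}} (hκ : ℵ₀ ≤ κ)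
    {𝒜 : Set (Set X)} (hA : ∀ A ∈ 𝒜, κ ≤ #A) (h : HereditarilyEssentiallyDisjoint κ 𝒜) :
    IndexedSeparable κ 𝒜 := by
  intro H hH
  obtain ⟨F, hF, hd⟩ := h H hH
  refine ⟨fun A => H A \ F (H A), fun A hAm => ⟨Set.sdiff_subset, ?_⟩, fun A hAm B hB hAB => ?_⟩
  · refine (mk_le_mk_of_subset ?_).trans_lt (hF _ ⟨A, hAm, rfl⟩).2
    rw [Set.sdiff_sdiff_right_self]
    exact Set.inter_subset_right
  · refine hd ⟨A, hAm, rfl⟩ ⟨B, hB, rfl⟩ fun he => ?_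
    refine (h.mk_inter_lt hκ hA hAm hB hAB).not_ge ?_
    rw [← (hH A hAm).2]
    exact mk_le_mk_of_subset (Set.subset_inter (hH A hAm).1 (he ▸ (hH B hB).1))

theorem IndexedSeparable.mono {κ : Cardinal.{u}} {𝒜 ℬ : Set (Set X)} (hA : ∀ A ∈ 𝒜, κ ≤ #A)
    (h : IndexedSeparable κ 𝒜) (hB : ℬ ⊆ 𝒜) : IndexedSeparable κ ℬ := by
  classical
  intro H hH
  obtain ⟨H₀, hH₀⟩ := exists_subset_mk_eq hA
  obtain ⟨G, hG, hd⟩ := h (fun A => if A ∈ ℬ then H A else H₀ A) fun A hAm => by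
    by_cases hm : A ∈ ℬ
    · simpa [hm] using hH A hm
    · simpa [hm] using hH₀ A hAm
  exact ⟨G, fun A hAm => by simpa [hAm] using hG A (hB hAm), hd.subset hB⟩

/-- Take H A inside A ∩ C δ for the least possible δ. As G A omits fewer than κ points of H A, it
meets every later C δ too. -/
theorem IndexedSeparable.exists_meeting {κ : Cardinal.{u}} {ℬ : Set (Set X)}
    (hℬ : ∀ A ∈ ℬ, κ ≤ #A) (h : IndexedSeparable κ ℬ) {C : Ordinal.{u} → Set X}
    (hC : Monotone C) :
    ∃ G : Set X → Set X, (∀ A ∈ ℬ, ∀ δ, κ ≤ #(A ∩ C δ : Set X) → (G A ∩ C δ).Nonempty) ∧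
      ℬ.PairwiseDisjoint G := by
  have : ∀ A : Set X, ∃ T, A ∈ ℬ →
      T ⊆ A ∧ #T = κ ∧ ∀ δ, κ ≤ #(A ∩ C δ : Set X) → T ⊆ C δ := fun A => by
    by_cases hA : A ∈ ℬ
    · by_cases hex : ∃ δ, κ ≤ #(A ∩ C δ : Set X)
      · have hmem : sInf {δ | κ ≤ #(A ∩ C δ : Set X)} ∈ {δ | κ ≤ #(A ∩ C δ : Set X)} :=
          csInf_mem hex
        obtain ⟨T, hT, hTκ⟩ := le_mk_iff_exists_subset.1 (Set.mem_ofPred.1 hmem)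
        refine ⟨T, fun _ => ⟨hT.trans Set.inter_subset_left, hTκ, fun δ hδ => ?_⟩⟩
        exact (hT.trans Set.inter_subset_right).trans (hC (csInf_le' hδ))
      · obtain ⟨T, hT, hTκ⟩ := le_mk_iff_exists_subset.1 (hℬ A hA)
        exact ⟨T, fun _ => ⟨hT, hTκ, fun δ hδ => (hex ⟨δ, hδ⟩).elim⟩⟩
    · exact ⟨∅, fun h' => (hA h').elim⟩
  choose H hH using this
  obtain ⟨G, hG, hd⟩ := h H fun A hA => ⟨(hH A hA).1, (hH A hA).2.1⟩
  refine ⟨G, fun A hA δ hδ => ?_, hd⟩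
  obtain ⟨-, h2, h3⟩ := hH A hA
  by_contra hne
  have hsub : H A ⊆ H A \ G A := fun x hx => ⟨hx, fun hxG => hne ⟨x, hxG, h3 δ hδ hx⟩⟩
  exact ((mk_le_mk_of_subset hsub).trans_lt (hG A hA).2).ne h2

/-! ### Closures and enumerations. -/

/-- The closure of `S` under the set-valued binary operation `Ψ`. -/
def opClosure (Ψ : X → X → Set X) (S : Set X) : Set X :=
  ⋂₀ {T | S ⊆ T ∧ ∀ x ∈ T, ∀ y ∈ T, Ψ x y ⊆ T}

section opClosure

variable {Ψ Ψ' : X → X → Set X} {S T : Set X}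

theorem subset_opClosure : S ⊆ opClosure Ψ S := Set.subset_sInter fun _ hT => hT.1

theorem opClosure_subset (hS : S ⊆ T) (hT : ∀ x ∈ T, ∀ y ∈ T, Ψ x y ⊆ T) : opClosure Ψ S ⊆ T :=
  Set.sInter_subset_of_mem ⟨hS, hT⟩

theorem op_subset_opClosure {x y : X} (hx : x ∈ opClosure Ψ S) (hy : y ∈ opClosure Ψ S) :
    Ψ x y ⊆ opClosure Ψ S := fun _ hz T hT => hT.2 x (hx T hT) y (hy T hT) hz

theorem opClosure_mono (hS : S ⊆ T) (hΨ : ∀ x y, Ψ x y ⊆ Ψ' x y) :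
    opClosure Ψ S ⊆ opClosure Ψ' T :=
  opClosure_subset (hS.trans subset_opClosure) fun x hx y hy =>
    (hΨ x y).trans (op_subset_opClosure hx hy)

theorem mk_opClosure_le {ρ : Cardinal.{u}} (hρ : ℵ₀ ≤ ρ) (hΨ : ∀ x y, #(Ψ x y) ≤ ρ)
    (hS : #S ≤ ρ) : #(opClosure Ψ S) ≤ ρ := by
  let step : Set X → Set X := fun S => S ∪ ⋃ x ∈ S, ⋃ y ∈ S, Ψ x y
  let U : ℕ → Set X := fun n => step^[n] S
  have hsucc : ∀ n, U (n + 1) = step (U n) := fun n => Function.iterate_succ_apply' step n S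
  have hmono : Monotone U := monotone_nat_of_le_succ fun n => by
    rw [hsucc]; exact Set.subset_union_left
  have hcard : ∀ n, #(U n) ≤ ρ := fun n => by
    induction n with
    | zero => exact hS
    | succ n ih =>
      rw [hsucc]
      refine (mk_union_le _ _).trans (add_le_of_le hρ ih ?_)
      exact mk_biUnion_le_of_forall_le hρ ih fun x _ =>
        mk_biUnion_le_of_forall_le hρ ih fun y _ => hΨ x y
  refine (mk_le_mk_of_subset (opClosure_subset (T := ⋃ n : ULift.{u} ℕ, U n.down) ?_ ?_)).trans ?_
  · exact fun x hx => Set.mem_iUnion.2 ⟨⟨0⟩, hx⟩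
  · intro x hx y hy z hz
    obtain ⟨⟨m⟩, hm⟩ := Set.mem_iUnion.1 hx
    obtain ⟨⟨n⟩, hn⟩ := Set.mem_iUnion.1 hy
    refine Set.mem_iUnion.2 ⟨⟨max m n + 1⟩, ?_⟩
    change z ∈ U (max m n + 1)
    rw [hsucc]
    have hm' : x ∈ U (max m n) := hmono (le_max_left m n) hm
    have hn' : y ∈ U (max m n) := hmono (le_max_right m n) hn
    exact Or.inr (Set.mem_biUnion hm' (Set.mem_biUnion hn' hz))
  · refine (mk_iUnion_le fun n : ULift.{u} ℕ => U n.down).trans ?_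
    have h1 : #(ULift.{u} ℕ) ≤ ρ := by simpa using hρ
    have h2 : ⨆ n : ULift.{u} ℕ, #(U n.down) ≤ ρ := ciSup_le' fun n => hcard n.down
    exact (mul_le_mul' h1 h2).trans (mul_eq_self hρ).le

end opClosure

theorem exists_enumeration (Y : Set X) : ∃ e : X → Ordinal.{u},
    Set.InjOn e Y ∧ ∀ x ∈ Y, e x < (#Y).ord := by
  classical
  have hc : #Y = #((#Y).ord.ToType) := (mk_ord_toType _).symm
  obtain ⟨f⟩ := Cardinal.eq.1 hc
  let g : Y → Set.Iio (#Y).ord := fun y => Ordinal.ToType.mk.symm (f y)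
  have hg : Function.Injective g := Ordinal.ToType.mk.symm.injective.comp f.injective
  refine ⟨fun x => if h : x ∈ Y then (g ⟨x, h⟩ : Ordinal) else 0, fun x hx y hy hxy => ?_,
    fun x hx => ?_⟩
  · simp only [hx, hy, dif_pos] at hxy
    simpa using hg (Subtype.ext hxy)
  · simp only [hx, dif_pos]
    exact (g ⟨x, hx⟩).2

theorem mk_initialSegment_lt {Y : Set X} {e : X → Ordinal.{u}}
    (he : Set.InjOn e Y) {δ : Ordinal.{u}} (hδ : δ < (#Y).ord) :
    #{y ∈ Y | e y < δ} < #Y := by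
  have h := lift_mk_le_lift_mk_of_injective
    (f := fun y : {y ∈ Y | e y < δ} => (⟨e y, y.2.2⟩ : Set.Iio δ))
    fun x y hxy => Subtype.ext (he x.2.1 y.2.1 (congrArg Subtype.val hxy))
  rw [mk_Iio_ordinal, lift_lift, lift_le] at h
  exact h.trans_lt (lt_ord.1 hδ)

theorem exists_wellFounded_rec {T : Type*}
    (F : (β : Ordinal.{u}) → ((γ : Ordinal.{u}) → γ < β → T) → T) :
    ∃ J : Ordinal.{u} → T, ∀ β, J β = F β fun γ _ => J γ :=
  ⟨_, WellFounded.fix_eq Ordinal.lt_wf F⟩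

/-! ### Catching ranks from chains of closed sets. -/

/-- The operation whose closed sets `S` contain, whenever they contain points `x` and `y` coding
sets `A ∈ D x` and `B ∈ D y`, the sets `φ x`, `N A` and, if `A ≠ B`, also `A ∩ B ∩ Y`. -/
def codeOp (φ : X → Set X) (N : Set X → Set X) (D : X → Set (Set X)) (Y : Set X) (x y : X) :
    Set X :=
  φ x ∪ (⋃ A ∈ D x, N A) ∪ ⋃ A ∈ D x, ⋃ B ∈ D y, {z ∈ Y | A ≠ B ∧ z ∈ A ∩ B}

section codeOp

variable {φ : X → Set X} {N : Set X → Set X} {D D' : X → Set (Set X)} {Y : Set X} {x y z : X}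

theorem mem_codeOp : z ∈ codeOp φ N D Y x y ↔ z ∈ φ x ∨ (∃ A ∈ D x, z ∈ N A) ∨
    ∃ A ∈ D x, ∃ B ∈ D y, z ∈ Y ∧ A ≠ B ∧ z ∈ A ∩ B := by
  simp only [codeOp, Set.mem_union, Set.mem_iUnion, exists_prop, or_assoc]
  rfl

theorem codeOp_mono (hx : D x ⊆ D' x) (hy : D y ⊆ D' y) :
    codeOp φ N D Y x y ⊆ codeOp φ N D' Y x y := fun z hz => by
  rw [mem_codeOp] at hz ⊢
  rcases hz with h | ⟨A, hA, h⟩ | ⟨A, hA, B, hB, h⟩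
  · exact Or.inl h
  · exact Or.inr (Or.inl ⟨A, hx hA, h⟩)
  · exact Or.inr (Or.inr ⟨A, hx hA, B, hy hB, h⟩)

theorem codeOp_subset {ℬ : Set (Set X)} (hφ : ∀ x, φ x ⊆ Y) (hN : ∀ A ∈ ℬ, N A ⊆ A ∩ Y)
    (hD : ∀ x, D x ⊆ ℬ) : codeOp φ N D Y x y ⊆ Y := fun z hz => by
  rw [mem_codeOp] at hz
  rcases hz with h | ⟨A, hA, h⟩ | ⟨A, hA, B, hB, h⟩
  · exact hφ x h
  · exact (hN A (hD x hA) h).2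
  · exact h.1

theorem mk_codeOp_le {ρ : Cardinal.{u}} {ℬ : Set (Set X)} (hρ : ℵ₀ ≤ ρ)
    (hℬ : ∀ A ∈ ℬ, ∀ B ∈ ℬ, A ≠ B → #(A ∩ B : Set X) ≤ ρ) (hφ : ∀ x, #(φ x) ≤ ρ)
    (hN : ∀ A ∈ ℬ, #(N A) ≤ ρ) (hD : ∀ x, D x ⊆ ℬ) (hDρ : ∀ x, #(D x) ≤ ρ) :
    #(codeOp φ N D Y x y) ≤ ρ := by
  refine (mk_union_le _ _).trans (add_le_of_le hρ
    ((mk_union_le _ _).trans (add_le_of_le hρ (hφ x) ?_)) ?_)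
  · exact mk_biUnion_le_of_forall_le hρ (hDρ x) fun A hA => hN A (hD x hA)
  · refine mk_biUnion_le_of_forall_le hρ (hDρ x) fun A hA =>
      mk_biUnion_le_of_forall_le hρ (hDρ y) fun B hB => ?_
    by_cases h : A = B
    · simp [h]
    · exact (mk_le_mk_of_subset fun z hz => hz.2.2).trans (hℬ A (hD x hA) B (hD y hB) h)

end codeOp

/-- The first part of `Y` in the enumeration `e`. -/
def initialSegment (Y : Set X) (e : X → Ordinal.{u}) (δ : Ordinal.{u}) : Set X :=
  {y ∈ Y | e y < δ}

theorem initialSegment_mono (Y : Set X) (e : X → Ordinal.{u}) : Monotone (initialSegment Y e) :=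
  fun _ _ h _ hx => ⟨hx.1, hx.2.trans_le h⟩

/-- A rank function on `Y` splits `Y` into fewer points per rank such that every member of `ℬ`
is caught at a unique rank, and members that are caught before `β` meet only before `β`. -/
structure IsCatchingRank (κ : Cardinal.{u}) (ℬ : Set (Set X)) (Y : Set X) (r : X → Ordinal.{u}) :
    Prop where
  mk_piece_lt : ∀ β, #{x ∈ Y | r x = β} < #Y
  exists_catch : ∀ B ∈ ℬ, ∃ β,
    κ ≤ #(B ∩ {x ∈ Y | r x = β} : Set X) ∧ #(B ∩ {x ∈ Y | r x < β} : Set X) < κ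
  inter_lt : ∀ β, ∀ A ∈ ℬ, ∀ B ∈ ℬ, A ≠ B → κ ≤ #(A ∩ {x ∈ Y | r x < β} : Set X) →
    κ ≤ #(B ∩ {x ∈ Y | r x < β} : Set X) → ∀ x ∈ Y, x ∈ A → x ∈ B → r x < β

/-- The rank of z is the least γ at which z enters the closure of the initial segment `succ γ`. By
`hcode`, a set with κ points in a closure has a code there; codes pull in κ points of their sets and
the intersections of two coded sets. -/
theorem exists_catchingRank_of_code {κ ρ : Cardinal.{u}} (hκ : ℵ₀ ≤ κ) {ℬ : Set (Set X)}
    {Y : Set X} (hℬ : ∀ A ∈ ℬ, κ ≤ #(A ∩ Y : Set X))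
    (hinter : ∀ A ∈ ℬ, ∀ B ∈ ℬ, A ≠ B → #(A ∩ B : Set X) < κ)
    {e : X → Ordinal.{u}} (he : Set.InjOn e Y) (heY : ∀ x ∈ Y, e x < (#Y).ord)
    {φ : X → Set X} {N : Set X → Set X} {D : X → Set (Set X)} (hφ : ∀ x, φ x ⊆ Y)
    (hN : ∀ A ∈ ℬ, N A ⊆ A ∩ Y ∧ #(N A) = κ) (hD : ∀ x, D x ⊆ ℬ)
    (hκρ : κ ≤ ρ) (hρ : ρ < #Y) (hφρ : ∀ x, #(φ x) ≤ ρ) (hDρ : ∀ x, #(D x) ≤ ρ)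
    (hcode : ∀ δ, ∀ B ∈ ℬ,
      κ ≤ #(B ∩ opClosure (codeOp φ N D Y) (initialSegment Y e δ) : Set X) →
      ∃ x ∈ opClosure (codeOp φ N D Y) (initialSegment Y e δ), B ∈ D x) :
    ∃ r, IsCatchingRank κ ℬ Y r := by
  have hρ₀ := hκ.trans hκρ
  set C : Ordinal.{u} → Set X := fun δ =>
    opClosure (codeOp φ N D Y) (initialSegment Y e δ) with hC
  have hCY : ∀ δ, C δ ⊆ Y := fun δ => opClosure_subset (fun x hx => hx.1) fun x _ y _ =>
    codeOp_subset hφ (fun A hA => (hN A hA).1) hD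
  have hCm : Monotone C := fun δ ε h =>
    opClosure_mono (initialSegment_mono Y e h) fun _ _ => subset_rfl
  -- Continuity of the chain: the operation is binary, and two points always share an earlier stage.
  have hcont : ∀ δ, ∀ z ∈ C δ, ∃ γ < δ, z ∈ C (Order.succ γ) := fun δ z hz => by
    refine opClosure_subset (T := {z | ∃ γ < δ, z ∈ C (Order.succ γ)}) ?_ ?_ hz
    · exact fun y hy => ⟨e y, hy.2, subset_opClosure ⟨hy.1, Order.lt_succ _⟩⟩
    · rintro x ⟨γ, hγ, hx⟩ y ⟨γ', hγ', hy⟩ w hw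
      refine ⟨max γ γ', max_lt hγ hγ', op_subset_opClosure ?_ ?_ hw⟩
      · exact hCm (Order.succ_le_succ (le_max_left _ _)) hx
      · exact hCm (Order.succ_le_succ (le_max_right _ _)) hy
  have hmemY : ∀ z ∈ Y, z ∈ C (Order.succ (e z)) := fun z hz =>
    subset_opClosure ⟨hz, Order.lt_succ _⟩
  set r : X → Ordinal.{u} := fun z => sInf {γ | z ∈ C (Order.succ γ)} with hr
  have hrmem : ∀ z ∈ Y, z ∈ C (Order.succ (r z)) := fun z hz =>
    csInf_mem (s := {γ | z ∈ C (Order.succ γ)}) ⟨_, hmemY z hz⟩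
  have hrle : ∀ z γ, z ∈ C (Order.succ γ) → r z ≤ γ := fun z γ h => csInf_le' h
  have hrC : ∀ β, {x ∈ Y | r x < β} = C β := fun β => by
    ext z
    constructor
    · rintro ⟨hz, h⟩
      exact hCm (Order.succ_le_of_lt h) (hrmem z hz)
    · intro hz
      obtain ⟨γ, hγ, h⟩ := hcont β z hz
      exact ⟨hCY _ hz, (hrle z γ h).trans_lt hγ⟩
  have hcatch : ∀ x, ∀ B ∈ D x, ∀ β, x ∈ C β → κ ≤ #(B ∩ C β : Set X) := fun x B hB β hx => by
    rw [← (hN B (hD x hB)).2]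
    refine mk_le_mk_of_subset (Set.subset_inter
      ((hN B (hD x hB)).1.trans Set.inter_subset_left) fun z hz => ?_)
    exact op_subset_opClosure hx hx (mem_codeOp.2 (Or.inr (Or.inl ⟨B, hB, hz⟩)))
  refine ⟨r, fun β => ?_, fun B hB => ?_, fun β A hA B hB hAB h1 h2 x hxY hxA hxB => ?_⟩
  · rcases Set.eq_empty_or_nonempty {x ∈ Y | r x = β} with h | ⟨x, hxY, hx⟩
    · rw [h, mk_eq_zero]
      exact (aleph0_pos.trans_le hρ₀).trans hρ
    · have hlt : Order.succ β < (#Y).ord := by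
        refine (isSuccLimit_ord (hρ₀.trans hρ.le)).succ_lt ((?_ : β ≤ e x).trans_lt (heY x hxY))
        exact hx ▸ hrle x _ (hmemY x hxY)
      have hsub : {x ∈ Y | r x = β} ⊆ C (Order.succ β) := fun z hz => hz.2 ▸ hrmem z hz.1
      refine (mk_le_mk_of_subset hsub).trans_lt ?_
      refine (mk_opClosure_le (ρ := max ρ #(initialSegment Y e (Order.succ β)))
        (hρ₀.trans (le_max_left _ _)) (fun x y => ?_) (le_max_right _ _)).trans_lt
        (max_lt hρ (mk_initialSegment_lt he hlt))
      exact (mk_codeOp_le hρ₀ (fun A hA B hB h => (hinter A hA B hB h).le.trans hκρ) hφρ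
        (fun A hA => (hN A hA).2.le.trans hκρ) hD hDρ).trans (le_max_left _ _)
  · have hne : {β | κ ≤ #(B ∩ C β : Set X)}.Nonempty := by
      refine ⟨(#Y).ord, (hℬ B hB).trans (mk_le_mk_of_subset ?_)⟩
      exact Set.inter_subset_inter_right _ fun y hy => subset_opClosure ⟨hy, heY y hy⟩
    set β₀ := sInf {β | κ ≤ #(B ∩ C β : Set X)} with hβ₀
    have hβmem : κ ≤ #(B ∩ C β₀ : Set X) := csInf_mem hne
    -- The code of B enters by stage `succ γ` with γ < β₀ and brings `N B` along, while B has fewer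
    -- than κ points in `C γ`. So B is caught exactly at γ.
    obtain ⟨x, hx, hBx⟩ := hcode β₀ B hB hβmem
    obtain ⟨γ, hγ, hxγ⟩ := hcont β₀ x hx
    have hlow : #(B ∩ C γ : Set X) < κ := not_le.1 fun h => hγ.not_ge (csInf_le' h)
    refine ⟨γ, ?_, (hrC γ).symm ▸ hlow⟩
    refine (le_mk_diff hκ (hcatch x B hBx _ hxγ) hlow).trans (mk_le_mk_of_subset ?_)
    rintro z ⟨⟨hzB, hz⟩, hz'⟩
    refine ⟨hzB, hCY _ hz, (hrle z γ hz).antisymm (not_lt.1 fun hlt => hz' ⟨hzB, ?_⟩)⟩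
    exact hrC γ ▸ ⟨hCY _ hz, hlt⟩
  · rw [hrC] at h1 h2
    obtain ⟨a, ha, hAa⟩ := hcode β A hA h1
    obtain ⟨b, hb, hBb⟩ := hcode β B hB h2
    have : x ∈ C β := op_subset_opClosure ha hb
      (mem_codeOp.2 (Or.inr (Or.inr ⟨A, hAa, B, hBb, hxY, hAB, hxA, hxB⟩)))
    rw [← hrC] at this
    exact this.2

/-- Here a point has at most κ predecessors, so `φ` can force closed sets to be initial segments.
One G chosen for initial segments then supplies all codes. -/
theorem exists_catchingRank_of_eq_succ {κ : Cardinal.{u}} (hκ : ℵ₀ ≤ κ) {ℬ : Set (Set X)}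
    {Y : Set X} (hℬ : ∀ A ∈ ℬ, κ ≤ #(A ∩ Y : Set X))
    (hinter : ∀ A ∈ ℬ, ∀ B ∈ ℬ, A ≠ B → #(A ∩ B : Set X) < κ)
    (hsep : IndexedSeparable κ ℬ) (hY : #Y = Order.succ κ) :
    ∃ r, IsCatchingRank κ ℬ Y r := by
  obtain ⟨e, he, heY⟩ := exists_enumeration Y
  have hℬ' : ∀ A ∈ ℬ, κ ≤ #A := fun A hA =>
    (hℬ A hA).trans (mk_le_mk_of_subset Set.inter_subset_left)
  have hN : ∃ N : Set X → Set X, ∀ A ∈ ℬ, N A ⊆ A ∩ Y ∧ #(N A) = κ := by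
    obtain ⟨N, hN⟩ := exists_subset_mk_eq (𝒜 := (· ∩ Y) '' ℬ) (κ := κ)
      (by rintro _ ⟨A, hA, rfl⟩; exact hℬ A hA)
    exact ⟨fun A => N (A ∩ Y), fun A hA => hN _ ⟨A, hA, rfl⟩⟩
  obtain ⟨N, hN⟩ := hN
  obtain ⟨G, hG, hd⟩ := hsep.exists_meeting hℬ' (initialSegment_mono Y e)
  set φ : X → Set X := fun x => {y ∈ Y | x ∈ Y ∧ e y ≤ e x} with hφ
  set D : X → Set (Set X) := fun x => {A ∈ ℬ | x ∈ G A} with hD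
  refine exists_catchingRank_of_code (ρ := κ) hκ hℬ hinter he heY (φ := φ) (D := D)
    (fun x y hy => hy.1) hN (fun x A hA => hA.1) le_rfl (hY ▸ Order.lt_succ κ) (fun x => ?_)
    (fun x => ?_) fun δ B hB hle => ?_
  · by_cases hx : x ∈ Y
    · have hlt : Order.succ (e x) < (#Y).ord :=
        (isSuccLimit_ord (hκ.trans (hY ▸ Order.le_succ κ))).succ_lt (heY x hx)
      rw [← Order.lt_succ_iff, ← hY]
      refine (mk_le_mk_of_subset ?_).trans_lt (mk_initialSegment_lt he hlt)
      exact fun y hy => ⟨hy.1, Order.lt_succ_of_le hy.2.2⟩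
    · have : φ x = ∅ := Set.eq_empty_of_forall_notMem fun y hy => hx hy.2.1
      rw [this, mk_eq_zero]
      exact zero_le
  · have : (D x).Subsingleton := fun A hA B hB => by
      by_contra hAB
      exact Set.disjoint_left.1 (hd hA.1 hB.1 hAB) hA.2 hB.2
    exact (mk_le_one_iff_set_subsingleton.2 this).trans (one_lt_aleph0.le.trans hκ)
  · set S := opClosure (codeOp φ N D Y) (initialSegment Y e δ) with hS
    have hSY : S ⊆ Y := opClosure_subset (fun x hx => hx.1) fun x _ y _ =>
      codeOp_subset (ℬ := ℬ) (fun x y hy => hy.1) (fun A hA => (hN A hA).1) (fun x A hA => hA.1)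
    have hne : {δ' | S ⊆ initialSegment Y e δ'}.Nonempty :=
      ⟨(#Y).ord, fun y hy => ⟨hSY hy, heY y (hSY hy)⟩⟩
    set δ' := sInf {δ' | S ⊆ initialSegment Y e δ'} with hδ'
    have hsub : S ⊆ initialSegment Y e δ' := csInf_mem hne
    have heq : initialSegment Y e δ' = S := by
      refine Set.Subset.antisymm (fun y hy => ?_) hsub
      by_contra hyS
      refine hy.2.not_ge (csInf_le' fun s hs => ⟨hSY hs, not_le.1 fun hle => hyS ?_⟩)
      exact op_subset_opClosure hs hs (mem_codeOp.2 (Or.inl ⟨hy.1, hSY hs, hle⟩))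
    obtain ⟨x, hxG, hx⟩ := hG B hB δ' (heq ▸ hle)
    exact ⟨x, heq ▸ hx, hB, hxG⟩

/-- Codes must meet closures that themselves depend on the codes. The circle is broken by
accumulating codes through κ⁺ rounds, which is affordable since κ⁺ < |Y|. -/
theorem exists_catchingRank_of_succ_lt {κ : Cardinal.{u}} (hκ : ℵ₀ ≤ κ) {ℬ : Set (Set X)}
    {Y : Set X} (hℬ : ∀ A ∈ ℬ, κ ≤ #(A ∩ Y : Set X))
    (hinter : ∀ A ∈ ℬ, ∀ B ∈ ℬ, A ≠ B → #(A ∩ B : Set X) < κ)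
    (hsep : IndexedSeparable κ ℬ) (hY : Order.succ κ < #Y) :
    ∃ r, IsCatchingRank κ ℬ Y r := by
  obtain ⟨e, he, heY⟩ := exists_enumeration Y
  have hℬ' : ∀ A ∈ ℬ, κ ≤ #A := fun A hA =>
    (hℬ A hA).trans (mk_le_mk_of_subset Set.inter_subset_left)
  have hN : ∃ N : Set X → Set X, ∀ A ∈ ℬ, N A ⊆ A ∩ Y ∧ #(N A) = κ := by
    obtain ⟨N, hN⟩ := exists_subset_mk_eq (𝒜 := (· ∩ Y) '' ℬ) (κ := κ)
      (by rintro _ ⟨A, hA, rfl⟩; exact hℬ A hA)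
    exact ⟨fun A => N (A ∩ Y), fun A hA => hN _ ⟨A, hA, rfl⟩⟩
  obtain ⟨N, hN⟩ := hN
  set Cl : (X → Set (Set X)) → Ordinal.{u} → Set X := fun D δ =>
    opClosure (codeOp (fun _ => ∅) N D Y) (initialSegment Y e δ) with hCl
  have hClm : ∀ D, Monotone (Cl D) := fun D δ ε h =>
    opClosure_mono (initialSegment_mono Y e h) fun _ _ => subset_rfl
  have hG := fun D => hsep.exists_meeting hℬ' (hClm D)
  choose G hG hd using hG
  obtain ⟨D, hD⟩ := exists_wellFounded_rec (T := X → Set (Set X)) fun ξ D x =>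
    {A ∈ ℬ | ∃ η, ∃ h : η < ξ, x ∈ G (D η h) A}
  have hDmem : ∀ ξ x A, A ∈ D ξ x ↔ A ∈ ℬ ∧ ∃ η < ξ, x ∈ G (D η) A := fun ξ x A => by
    rw [hD]; simp
  have hDm : ∀ {ξ ξ'} x, ξ ≤ ξ' → D ξ x ⊆ D ξ' x := fun x hle A hA => by
    rw [hDmem] at hA ⊢
    obtain ⟨h1, η, hη, h2⟩ := hA
    exact ⟨h1, η, hη.trans_le hle, h2⟩
  have hClD : ∀ {ξ ξ'} δ, ξ ≤ ξ' → Cl (D ξ) δ ⊆ Cl (D ξ') δ := fun δ hle =>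
    opClosure_mono subset_rfl fun x y => codeOp_mono (hDm x hle) (hDm y hle)
  set θ : Ordinal.{u} := (Order.succ κ).ord with hθ
  have hreg : (Order.succ κ).IsRegular := isRegular_succ hκ
  have hlim : Order.IsSuccLimit θ := isSuccLimit_ord hreg.aleph0_le
  have hDθ : ∀ {x A}, A ∈ D θ x → ∃ ξ < θ, A ∈ D ξ x := fun {x A} hA => by
    obtain ⟨h1, η, hη, h2⟩ := (hDmem _ _ _).1 hA
    exact ⟨Order.succ η, hlim.succ_lt hη, (hDmem _ _ _).2 ⟨h1, η, Order.lt_succ η, h2⟩⟩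
  refine exists_catchingRank_of_code (ρ := Order.succ κ) hκ hℬ hinter he heY (φ := fun _ => ∅)
    (D := D θ) (fun x => Set.empty_subset _) hN (fun x A hA => ((hDmem _ _ _).1 hA).1)
    (Order.le_succ κ) hY (fun x => by simp) (fun x => ?_) fun δ B hB hle => ?_
  · have hsub : D θ x ⊆ ⋃ η, ⋃ (_ : η < θ), {A ∈ ℬ | x ∈ G (D η) A} := fun A hA => by
      obtain ⟨h1, η, hη, h2⟩ := (hDmem _ _ _).1 hA
      exact Set.mem_biUnion (s := {η | η < θ}) hη ⟨h1, h2⟩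
    refine (mk_le_mk_of_subset hsub).trans (mk_biUnion_le_of_le ?_ hreg.aleph0_le _ fun η _ => ?_)
    · rw [hθ, card_ord]
    · have : {A ∈ ℬ | x ∈ G (D η) A}.Subsingleton := fun A hA B hB => by
        by_contra hAB
        exact Set.disjoint_left.1 (hd (D η) hA.1 hB.1 hAB) hA.2 hB.2
      exact (mk_le_one_iff_set_subsingleton.2 this).trans (one_lt_aleph0.le.trans hreg.aleph0_le)
  · have hex : ∀ z ∈ Cl (D θ) δ, ∃ ξ < θ, z ∈ Cl (D ξ) δ := fun z hz => by
      refine opClosure_subset (T := {z | ∃ ξ < θ, z ∈ Cl (D ξ) δ}) ?_ ?_ hz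
      · exact fun y hy => ⟨0, hlim.bot_lt, subset_opClosure hy⟩
      · rintro x ⟨ξ₁, h₁, hx⟩ y ⟨ξ₂, h₂, hy⟩ w hw
        have key : ∀ ξ, ξ < θ → w ∈ codeOp (fun _ => ∅) N (D ξ) Y x y →
            ∃ ξ < θ, w ∈ Cl (D ξ) δ := fun ξ hξ hw' => by
          refine ⟨max ξ (max ξ₁ ξ₂), max_lt hξ (max_lt h₁ h₂), ?_⟩
          refine op_subset_opClosure (hClD δ ((le_max_left ξ₁ ξ₂).trans (le_max_right _ _)) hx)
            (hClD δ ((le_max_right ξ₁ ξ₂).trans (le_max_right _ _)) hy) ?_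
          exact codeOp_mono (hDm x (le_max_left _ _)) (hDm y (le_max_left _ _)) hw'
        rcases mem_codeOp.1 hw with h | ⟨A, hA, h⟩ | ⟨A, hA, B, hB, h⟩
        · exact h.elim
        · obtain ⟨ξ, hξ, hA'⟩ := hDθ hA
          exact key ξ hξ (mem_codeOp.2 (Or.inr (Or.inl ⟨A, hA', h⟩)))
        · obtain ⟨ξ, hξ, hA'⟩ := hDθ hA
          obtain ⟨ξ', hξ', hB'⟩ := hDθ hB
          exact key (max ξ ξ') (max_lt hξ hξ') (mem_codeOp.2 (Or.inr (Or.inr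
            ⟨A, hDm x (le_max_left _ _) hA', B, hDm y (le_max_right _ _) hB', h⟩)))
    obtain ⟨T, hT, hTκ⟩ := le_mk_iff_exists_subset.1 hle
    choose ξ hξ hξT using fun t : T => hex t (hT t.2).2
    -- By regularity of κ⁺, κ points of the final closure already lie in the closure of one round,
    -- and the next round codes B there.
    have hsup : ⨆ t, ξ t < θ := by
      refine Ordinal.iSup_lt_of_lt_cof ?_ hξ
      rw [hθ, hreg.cof_ord, hTκ]
      exact Order.lt_succ κ
    obtain ⟨x, hxG, hx⟩ := hG (D (⨆ t, ξ t)) B hB δ <| by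
      rw [← hTκ]
      refine mk_le_mk_of_subset fun t ht => ⟨(hT ht).1, ?_⟩
      exact hClD δ (Ordinal.le_iSup ξ ⟨t, ht⟩) (hξT ⟨t, ht⟩)
    exact ⟨x, hClD δ hsup.le hx, (hDmem _ _ _).2 ⟨hB, _, hsup, hxG⟩⟩

theorem exists_catchingRank {κ : Cardinal.{u}} (hκ : ℵ₀ ≤ κ) {ℬ : Set (Set X)}
    {Y : Set X} (hℬ : ∀ A ∈ ℬ, κ ≤ #(A ∩ Y : Set X))
    (hinter : ∀ A ∈ ℬ, ∀ B ∈ ℬ, A ≠ B → #(A ∩ B : Set X) < κ)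
    (hsep : IndexedSeparable κ ℬ) (hY : κ < #Y) : ∃ r, IsCatchingRank κ ℬ Y r := by
  rcases (Order.succ_le_of_lt hY).eq_or_lt with h | h
  · exact exists_catchingRank_of_eq_succ hκ hℬ hinter hsep h.symm
  · exact exists_catchingRank_of_succ_lt hκ hℬ hinter hsep h

/-! ### Colorings avoiding forbidden colors. -/

variable {K : Type u}

/-- The coloring `c` of `Y` avoids the forbidden colors `Φ`, and for each `A ∈ 𝒜` that has at
least `κ` points in `Y`, the set `I A` is a large partial function all of whose elements are colors
of exactly one point of `A ∩ Y`. -/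
structure IsUniqueColoring (κ : Cardinal.{u}) (𝒜 : Set (Set X)) (Y : Set X)
    (Φ : X → Set (K × K)) (c : X → K × K) (I : Set X → Set (K × K)) : Prop where
  avoid : ∀ x ∈ Y, c x ∉ Φ x
  large : ∀ A ∈ 𝒜, κ ≤ #(A ∩ Y : Set X) → κ ≤ #(I A)
  slice : ∀ A ∈ 𝒜, κ ≤ #(A ∩ Y : Set X) → ∀ p, {y | (p, y) ∈ I A}.Subsingleton
  unique : ∀ A ∈ 𝒜, κ ≤ #(A ∩ Y : Set X) → ∀ q ∈ I A, ∃! x, x ∈ A ∩ Y ∧ c x = q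

theorem exists_uniqueColoring_of_mk_le {κ : Cardinal.{u}} (hκ : ℵ₀ ≤ κ) (hK : #K = κ)
    {𝒜 : Set (Set X)} (hA : ∀ A ∈ 𝒜, κ ≤ #A) (hsep : IndexedSeparable κ 𝒜)
    {Y : Set X} (hY : #Y ≤ κ) {Φ : X → Set (K × K)}
    (hΦ : ∀ x ∈ Y, ∀ p, #{y | (p, y) ∈ Φ x} < κ) :
    ∃ c I, IsUniqueColoring κ 𝒜 Y Φ c I := by
  set ℬ : Set (Set X) := {A ∈ 𝒜 | κ ≤ #(A ∩ Y : Set X)} with hℬ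
  obtain ⟨G, hG, hd⟩ := hsep.mono hA (fun A hA => hA.1 : ℬ ⊆ 𝒜) (· ∩ Y) fun A hA =>
    ⟨Set.inter_subset_left,
      ((mk_le_mk_of_subset Set.inter_subset_right).trans hY).antisymm hA.2⟩
  have hKne : Nonempty K := by
    rw [← mk_ne_zero_iff, hK]
    exact (aleph0_pos.trans_le hκ).ne'
  have hGκ : ∀ A ∈ ℬ, κ ≤ #(G A) := fun A hA => by
    have := le_mk_diff hκ hA.2 (hG A hA).2
    rwa [Set.sdiff_sdiff_cancel_left (hG A hA).1] at this
  have he : ∀ A : Set X, ∃ e : X → K, A ∈ ℬ → Set.InjOn e (G A) := fun A => by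
    classical
    by_cases hA : A ∈ ℬ
    · have : #(G A) ≤ #K := hK ▸
        (mk_le_mk_of_subset ((hG A hA).1.trans Set.inter_subset_right)).trans hY
      obtain ⟨f⟩ := this
      refine ⟨fun x => if h : x ∈ G A then f ⟨x, h⟩ else Classical.arbitrary K,
        fun _ x hx y hy hxy => ?_⟩
      simp only [hx, hy, dif_pos] at hxy
      exact congrArg Subtype.val (f.injective hxy)
    · exact ⟨fun _ => Classical.arbitrary K, fun h => (hA h).elim⟩
  choose e he using he
  have hfree : ∀ x p, ∃ y, x ∈ Y → (p, y) ∉ Φ x := fun x p => by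
    by_contra! hcon
    have hx : x ∈ Y := (hcon (Classical.arbitrary K)).1
    have : {y | (p, y) ∈ Φ x} = Set.univ := Set.eq_univ_of_forall fun y => (hcon y).2
    exact (hΦ x hx p).ne (by rw [this, mk_univ, hK])
  choose y hy using hfree
  have hc : ∀ x, ∃ p : K, ∀ A ∈ ℬ, x ∈ G A → p = e A x := fun x => by
    by_cases hx : ∃ A ∈ ℬ, x ∈ G A
    · obtain ⟨A, hA, hxA⟩ := hx
      refine ⟨e A x, fun B hB hxB => ?_⟩
      by_contra hne
      refine Set.disjoint_left.1 (hd hA hB fun h => hne (by rw [h])) hxA hxB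
    · exact ⟨Classical.arbitrary K, fun A hA hxA => (hx ⟨A, hA, hxA⟩).elim⟩
  choose p hp using hc
  set c : X → K × K := fun x => (p x, y x (p x)) with hcdef
  have hinj : ∀ A ∈ ℬ, ∀ x ∈ G A, ∀ x' ∈ G A, (c x).1 = (c x').1 → x = x' :=
    fun A hA x hx x' hx' h => by
      refine he A hA hx hx' ?_
      rw [← hp x A hA hx, ← hp x' A hA hx']
      exact h
  -- Fewer than κ points of A ∩ Y lie outside `G A`; removing their colors restores uniqueness.
  refine ⟨c, fun A => c '' G A \ c '' ((A ∩ Y) \ G A), fun x hx => hy x _ hx,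
    fun A hA hle => ?_, fun A hA hle p z hz z' hz' => ?_, fun A hA hle q hq => ?_⟩
  · refine le_mk_diff hκ ?_ (mk_image_le.trans_lt (hG A ⟨hA, hle⟩).2)
    rw [mk_image_eq_of_injOn _ _ fun x hx x' hx' h =>
      hinj A ⟨hA, hle⟩ x hx x' hx' (congrArg Prod.fst h)]
    exact hGκ A ⟨hA, hle⟩
  · obtain ⟨x, hx, hxz⟩ := hz.1
    obtain ⟨x', hx', hxz'⟩ := hz'.1
    have := hinj A ⟨hA, hle⟩ x hx x' hx' (by rw [hxz, hxz'])
    rw [this, hxz'] at hxz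
    exact (congrArg Prod.snd hxz).symm
  · obtain ⟨⟨x, hx, rfl⟩, hq⟩ := hq
    refine ⟨x, ⟨(hG A ⟨hA, hle⟩).1 hx, rfl⟩, fun x' hx' => ?_⟩
    by_cases hG' : x' ∈ G A
    · exact hinj A ⟨hA, hle⟩ x' hG' x hx (by rw [hx'.2])
    · exact (hq ⟨x', ⟨hx'.1, hG'⟩, hx'.2⟩).elim

theorem exists_uniqueColoring_of_catchingRank {κ : Cardinal.{u}} (hκ : ℵ₀ ≤ κ)
    {𝒜 : Set (Set X)} {Y : Set X} {r : X → Ordinal.{u}}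
    (hr : IsCatchingRank κ {A ∈ 𝒜 | κ ≤ #(A ∩ Y : Set X)} Y r)
    (ih : ∀ Z : Set X, #Z < #Y → ∀ Φ : X → Set (K × K),
      (∀ x ∈ Z, ∀ p, #{y | (p, y) ∈ Φ x} < κ) → ∃ c I, IsUniqueColoring κ 𝒜 Z Φ c I)
    {Φ : X → Set (K × K)} (hΦ : ∀ x ∈ Y, ∀ p, #{y | (p, y) ∈ Φ x} < κ) :
    ∃ c I, IsUniqueColoring κ 𝒜 Y Φ c I := by
  classical
  set ℬ : Set (Set X) := {A ∈ 𝒜 | κ ≤ #(A ∩ Y : Set X)} with hℬ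
  set Z : Ordinal.{u} → Set X := fun β => {x ∈ Y | r x = β} with hZ
  set W : Ordinal.{u} → Set X := fun β => {x ∈ Y | r x < β} with hW
  have hsol : ∀ β, ∀ Ψ : X → Set (K × K), ∃ s : (X → K × K) × (Set X → Set (K × K)),
      (∀ x ∈ Z β, ∀ p, #{y | (p, y) ∈ Ψ x} < κ) → IsUniqueColoring κ 𝒜 (Z β) Ψ s.1 s.2 :=
    fun β Ψ => by
      by_cases h : ∀ x ∈ Z β, ∀ p, #{y | (p, y) ∈ Ψ x} < κ
      · obtain ⟨c, I, hcI⟩ := ih (Z β) (hr.mk_piece_lt β) Ψ h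
        exact ⟨⟨c, I⟩, fun _ => hcI⟩
      -- A junk value; coloring ∅ supplies elements of K × K, as K is not assumed nonempty.
      · exact ⟨⟨fun x => (ih ∅ (by
          rw [mk_eq_zero]
          exact bot_le.trans_lt (hr.mk_piece_lt 0)) (fun _ => ∅) (fun x hx => hx.elim)).choose x,
          fun _ => ∅⟩, fun h' => (h h').elim⟩
  choose s hs using hsol
  obtain ⟨J, hJ⟩ := exists_wellFounded_rec (T := Set X → Set (K × K)) fun β J =>
    (s β fun x => Φ x ∪ {q | ∃ γ, ∃ h : γ < β, ∃ A ∈ ℬ, x ∈ A ∧ κ ≤ #(A ∩ Z γ : Set X) ∧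
      #(A ∩ W γ : Set X) < κ ∧ q ∈ J γ h A}).2
  set Ψ : Ordinal.{u} → X → Set (K × K) := fun β x => Φ x ∪ {q | ∃ γ, ∃ _ : γ < β, ∃ A ∈ ℬ,
    x ∈ A ∧ κ ≤ #(A ∩ Z γ : Set X) ∧ #(A ∩ W γ : Set X) < κ ∧ q ∈ J γ A} with hΨ
  have hJ' : ∀ β, J β = (s β (Ψ β)).2 := hJ
  have hZW : ∀ {γ β}, γ < β → Z γ ⊆ W β := fun h x hx => ⟨hx.1, hx.2.trans_lt h⟩
  have hcaught : ∀ {A : Set X} {γ β}, κ ≤ #(A ∩ Z γ : Set X) → γ < β → κ ≤ #(A ∩ W β : Set X) :=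
    fun h1 h2 => h1.trans (mk_le_mk_of_subset (Set.inter_subset_inter_right _ (hZW h2)))
  have hrank : ∀ {A : Set X} {γ γ'}, κ ≤ #(A ∩ Z γ : Set X) → #(A ∩ W γ' : Set X) < κ → γ' ≤ γ :=
    fun h1 h2 => not_lt.1 fun h => h2.not_ge (hcaught h1 h)
  have hgood : ∀ β, IsUniqueColoring κ 𝒜 (Z β) (Ψ β) (s β (Ψ β)).1 (J β) := fun β => by
    induction β using WellFoundedLT.induction with
    | ind β hβ =>
    rw [hJ']
    refine hs β (Ψ β) fun x hx p => ?_
    -- Two sets caught before β do not meet at rank β, and a set is caught only once; so `slice`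
    -- leaves at most one new color over p.
    have hsub : {q | ∃ γ, ∃ _ : γ < β, ∃ A ∈ ℬ, x ∈ A ∧ κ ≤ #(A ∩ Z γ : Set X) ∧
        #(A ∩ W γ : Set X) < κ ∧ (p, q) ∈ J γ A}.Subsingleton := by
      rintro q ⟨γ, hγ, A, hA, hxA, h1, h2, hq⟩ q' ⟨γ', hγ', A', hA', hxA', h1', h2', hq'⟩
      have hAA : A = A' := by
        by_contra hne
        exact (hr.inter_lt β A hA A' hA' hne (hcaught h1 hγ) (hcaught h1' hγ') x hx.1 hxA
          hxA').ne hx.2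
      subst hAA
      have hγγ : γ = γ' := (hrank h1' h2).antisymm (hrank h1 h2')
      subst hγγ
      exact (hβ γ hγ).slice A hA.1 h1 p hq hq'
    refine (mk_union_le {y | (p, y) ∈ Φ x} _).trans_lt (add_lt_of_lt hκ (hΦ x hx.1 p) ?_)
    exact (mk_le_one_iff_set_subsingleton.2 hsub).trans_lt (one_lt_aleph0.trans_le hκ)
  set c : X → K × K := fun x => (s (r x) (Ψ (r x))).1 x with hc
  have hcatch : ∀ A : Set X, ∃ β, A ∈ ℬ →
      κ ≤ #(A ∩ Z β : Set X) ∧ #(A ∩ W β : Set X) < κ := fun A => by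
    by_cases hA : A ∈ ℬ
    · obtain ⟨β, hβ⟩ := hr.exists_catch A hA
      exact ⟨β, fun _ => hβ⟩
    · exact ⟨0, fun h => (hA h).elim⟩
  choose β hβ using hcatch
  have havoid : ∀ x ∈ Y, c x ∉ Ψ (r x) x := fun x hx => (hgood (r x)).avoid x ⟨hx, rfl⟩
  refine ⟨c, fun A => J (β A) A \ c '' (A ∩ W (β A)), fun x hx h => havoid x hx (Or.inl h),
    fun A hA hle => ?_, fun A hA hle p z hz z' hz' => ?_, fun A hA hle q hq => ?_⟩
  · obtain ⟨h1, h2⟩ := hβ A ⟨hA, hle⟩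
    exact le_mk_diff hκ ((hgood (β A)).large A hA h1) (mk_image_le.trans_lt h2)
  · exact (hgood (β A)).slice A hA (hβ A ⟨hA, hle⟩).1 p hz.1 hz'.1
  · obtain ⟨h1, h2⟩ := hβ A ⟨hA, hle⟩
    obtain ⟨x, ⟨hx, hxq⟩, hux⟩ := (hgood (β A)).unique A hA h1 q hq.1
    have hcx : ∀ x ∈ Z (β A), c x = (s (β A) (Ψ (β A))).1 x := fun x hx => by
      simp only [hc, hx.2]
    refine ⟨x, ⟨⟨hx.1, hx.2.1⟩, (hcx x hx.2).trans hxq⟩, fun x' hx' => ?_⟩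
    obtain ⟨⟨hxA, hxY⟩, hxq'⟩ := hx'
    -- Earlier points had their colors discarded, the catching piece has uniqueness, and later
    -- points were forbidden these colors.
    rcases lt_trichotomy (r x') (β A) with h | h | h
    · exact (hq.2 ⟨x', ⟨hxA, hxY, h⟩, hxq'⟩).elim
    · exact hux x' ⟨⟨hxA, hxY, h⟩, (hcx x' ⟨hxY, h⟩).symm.trans hxq'⟩
    · refine (havoid x' hxY (Or.inr ⟨β A, h, A, ⟨hA, hle⟩, hxA, h1, h2, ?_⟩)).elim
      exact hxq' ▸ hq.1

theorem exists_uniqueColoring {κ : Cardinal.{u}} (hκ : ℵ₀ ≤ κ) (hK : #K = κ)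
    {𝒜 : Set (Set X)} (hA : ∀ A ∈ 𝒜, κ ≤ #A) (hsep : IndexedSeparable κ 𝒜)
    (hinter : ∀ A ∈ 𝒜, ∀ B ∈ 𝒜, A ≠ B → #(A ∩ B : Set X) < κ) (Y : Set X)
    (Φ : X → Set (K × K)) (hΦ : ∀ x ∈ Y, ∀ p, #{y | (p, y) ∈ Φ x} < κ) :
    ∃ c I, IsUniqueColoring κ 𝒜 Y Φ c I := by
  induction hμ : #Y using WellFoundedLT.induction generalizing Y Φ with
  | ind μ ih =>
  subst hμ
  rcases le_or_gt #Y κ with hY | hY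
  · exact exists_uniqueColoring_of_mk_le hκ hK hA hsep hY hΦ
  · obtain ⟨r, hr⟩ := exists_catchingRank hκ (ℬ := {A ∈ 𝒜 | κ ≤ #(A ∩ Y : Set X)})
      (fun A hA => hA.2) (fun A hA B hB => hinter A hA.1 B hB.1)
      (hsep.mono hA fun A hA => hA.1) hY
    exact exists_uniqueColoring_of_catchingRank hκ hr
      (fun Z hZ Φ hΦ => ih #Z hZ Z Φ hΦ rfl) hΦ

end SetFamily

/-! ### The coloring of X, with K × K recoded as K. -/

theorem theorem4p1 (lam κ : Cardinal.{u}) (hω : ℵ₀ ≤ κ) (hκ : κ ≤ lam)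
    (X K : Type u) (hX : #X = lam) (hK : #K = κ)
    (𝒜 : Set (Set X)) (hA : ∀ A ∈ 𝒜, κ ≤ #A)
    (hED : SetFamily.HereditarilyEssentiallyDisjoint κ 𝒜) :
    ∃ c : X → K, ∀ A ∈ 𝒜, #(SetFamily.uniqueColors c A) = κ := by
  obtain ⟨c, I, hcI⟩ := SetFamily.exists_uniqueColoring hω hK hA
    (hED.indexedSeparable hω hA) (fun A hAm B hB => hED.mk_inter_lt hω hA hAm hB) Set.univ
    (fun _ => ∅) fun x _ p => by simpa using aleph0_pos.trans_le hω
  have hKK : #(K × K) = #K := by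
    rw [mk_prod, lift_id, hK, mul_eq_self hω]
  obtain ⟨f⟩ := Cardinal.eq.1 hKK
  refine ⟨f ∘ c, fun A hAm => (hK ▸ mk_set_le _).antisymm ?_⟩
  have hle : κ ≤ #(A ∩ Set.univ : Set X) := by simpa using hA A hAm
  refine (hcI.large A hAm hle).trans ?_
  rw [← mk_image_eq f.injective]
  refine mk_le_mk_of_subset ?_
  rintro _ ⟨q, hq, rfl⟩
  obtain ⟨x, ⟨hx, rfl⟩, hux⟩ := hcI.unique A hAm hle q hq
  refine ⟨⟨x, rfl⟩, mk_set_eq_one_iff.2 ⟨x, ?_⟩⟩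
  ext z
  simp only [Set.mem_inter_iff, Set.mem_preimage, Function.comp_apply, Set.mem_singleton_iff,
    EmbeddingLike.apply_eq_iff_eq]
  exact ⟨fun h => hux z ⟨⟨h.1, trivial⟩, h.2⟩, fun h => by rw [h]; exact ⟨hx.1, rfl⟩⟩
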